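/- Let $P,Q\in\mathbb R[s]$ be arbitrary polynomials, let $I\subseteq\mathbb R$ be an interval (for instance $[1,\infty)$ or $\mathbb R$), and put $R(s,r):=rP(s)-Q(s)^r$ wherever $Q(s)>0$. Let $D$ be the set of all $s\in I$ with $Q(s)>0$ for which the equation $rP(s)=Q(s)^r$ has a real root $r$. Local maxima and minima of a function on $D$ are understood relative to $D$ and need not be strict, so boundary points of $D$ are allowed. Then: 1. For every $s\in D$ the equation $rP(s)=Q(s)^r$ has a largest real root $r(s)$. This defines the implicit function $r\colon D\to\mathbb R$, with $R(s,r(s))=0$. 2. Apart from the points in a neighbourhood of which $r$ is defined and constant, $r$ has only finitely many local maxima and minima. 3. If $s$ is an interior point of $D$ with $Q(s)\neq 1$ and $r$ has a local maximum or minimum at $s$, then $(s,r(s))$ is a solution of the Pfaffian system $R=\partial R/\partial s=0$. 4. Suppose that there are no constant $c\in\mathbb R$ and no nonempty open interval $J\subseteq I$ such that $Q>0$ and $cP=Q^c$ on $J$. Then $r$ has only finitely many local maxima and minima, and the system $R=\partial R/\partial s=0$ has only finitely many solutions $(s,r)$ with $s\in I$ and $Q(s)>0$. -/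

import Mathlib

open Polynomial Filter Topology Set

noncomputable section

/-- `R(s, r) = r P(s) - Q(s)^r`, to be used where `Q(s) > 0`. -/
def curveR (P Q : ℝ[X]) (s r : ℝ) : ℝ := r * P.eval s - (Q.eval s) ^ r

/-- The real roots `r` of `r P(s) = Q(s)^r` for a fixed `s`. -/
def rootsAt (P Q : ℝ[X]) (s : ℝ) : Set ℝ := {r | r * P.eval s = (Q.eval s) ^ r}

/-- The points `s` of `I` where `Q(s)^r` makes sense for all real `r` (that is, `Q(s) > 0`)
and where `r P(s) = Q(s)^r` has a root. -/
def implicitDomain (P Q : ℝ[X]) (I : Set ℝ) : Set ℝ :=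
  {s | s ∈ I ∧ 0 < Q.eval s ∧ (rootsAt P Q s).Nonempty}

/-- The largest root `r(s)` of `r P(s) = Q(s)^r`, meaningful on the domain above. -/
def implicitR (P Q : ℝ[X]) (s : ℝ) : ℝ := sSup (rootsAt P Q s)

/-- The solutions `(s, r)`, with `s ∈ I` and `Q(s) > 0`, of the system `R = ∂R/∂s = 0`. -/
def pfaffianSolutions (P Q : ℝ[X]) (I : Set ℝ) : Set (ℝ × ℝ) :=
  {p | p.1 ∈ I ∧ 0 < Q.eval p.1 ∧ curveR P Q p.1 p.2 = 0 ∧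
    deriv (fun s => curveR P Q s p.2) p.1 = 0}

/-- No identity `c P = Q^c`, with a constant `c`, holds on a nonempty open interval inside `I`
on which `Q` is positive. -/
def NoConstantRoot (P Q : ℝ[X]) (I : Set ℝ) : Prop :=
  ∀ c a b : ℝ, a < b → Ioo a b ⊆ I →
    ¬ ∀ s ∈ Ioo a b, 0 < Q.eval s ∧ c * P.eval s = (Q.eval s) ^ c

end

/-! ### Finiteness by Rolle's theorem -/

/-! For fixed `s` put `p = P(s)`, `L = log Q(s)`. The function `r ↦ r p - exp (L r)` is concave with
finitely many zeros, so a nonempty root set has a maximum. If `p * L > 0`, a root forces `p / L ≥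
e`, with equality only at a tangency.

Away from tangencies and isolated points where `Q = 1`, the sign of `R(t, r)` tells on which side of
`r(t)` the number `r` lies, uniformly for `t` near `s` (`implicitR_local_sign`). An extremum of
`r(t)` at `s` then makes `s` an extremum of `t ↦ R(t, r(s))`, so `∂R/∂s = 0`. At an interior
tangency, `P - e log Q` itself has an extremum, which gives the same equation.

Eliminating `Q^r` from the Pfaffian system gives `r = ρ = P'Q / (PQ')`, hence `h = ρ log Q - log (ρ
P) = 0`. Since `h' = ρ' (log Q - 1/ρ)` and the derivative of the last factor is rational, Rolle's
theorem applied twice bounds the solutions, unless `ρ` is constant; then solutions lie on horizontal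
segments of `R = 0` (`finite_pfaffian_not_eventually`). -/

theorem finite_zeros_of_finite_zeros_deriv {F : Set ℝ} (hF : F.Finite) {f f' : ℝ → ℝ}
    (hf : ∀ t, t ∉ F → HasDerivAt f (f' t) t) (hz : {t | t ∉ F ∧ f' t = 0}.Finite) :
    {t | t ∉ F ∧ f t = 0}.Finite := by
  set G : Set ℝ := F ∪ {t | t ∉ F ∧ f' t = 0} with hGdef
  have hG : G.Finite := hF.union hz
  suffices h : {t | t ∉ G ∧ f t = 0}.Finite by
    refine (hG.union h).subset fun t ht => ?_
    by_cases htG : t ∈ G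
    · exact Or.inl htG
    · exact Or.inr ⟨htG, ht.2⟩
  -- `G ∩ Iio t` labels the gap of `G` containing `t`; by Rolle each gap holds at most one zero of
  -- `f`.
  refine Finite.of_finite_image (f := fun t => G ∩ Iio t)
    (hG.finite_subsets.subset ?_) ?_
  · rintro _ ⟨t, -, rfl⟩
    exact inter_subset_left
  · have key : ∀ x y, x ∉ G → y ∉ G → f x = 0 → f y = 0 → G ∩ Iio x = G ∩ Iio y → ¬ x < y := by
      intro x y hx hy hfx hfy hxy hlt
      have hno : ∀ t ∈ Icc x y, t ∉ G := by
        intro t ht htG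
        rcases eq_or_lt_of_le ht.2 with h | h
        · exact hy (h ▸ htG)
        · have : t ∈ G ∩ Iio x := hxy ▸ ⟨htG, h⟩
          exact absurd this.2 (not_lt.2 ht.1)
      have hd : ∀ t ∈ Icc x y, HasDerivAt f (f' t) t := fun t ht =>
        hf t fun h => hno t ht (Or.inl h)
      obtain ⟨c, hc, hc0⟩ := exists_hasDerivAt_eq_zero hlt
        (fun t ht => (hd t ht).continuousAt.continuousWithinAt) (hfx.trans hfy.symm)
        (fun t ht => hd t (Ioo_subset_Icc_self ht))
      have hcc := hno c (Ioo_subset_Icc_self hc)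
      exact hcc (Or.inr ⟨fun h => hcc (Or.inl h), hc0⟩)
    intro x hx y hy hxy
    rcases lt_trichotomy x y with h | h | h
    · exact absurd h (key x y hx.1 hy.1 hx.2 hy.2 hxy)
    · exact h
    · exact absurd h (key y x hy.1 hx.1 hy.2 hx.2 hxy.symm)

theorem eventually_eq_of_eventually_hasDerivAt_zero {f : ℝ → ℝ} {s : ℝ}
    (h : ∀ᶠ t in 𝓝 s, HasDerivAt f 0 t) : ∀ᶠ t in 𝓝 s, f t = f s := by
  obtain ⟨ε, hε, hb⟩ := Metric.eventually_nhds_iff_ball.1 h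
  filter_upwards [Metric.ball_mem_nhds s hε] with t ht
  exact Metric.isOpen_ball.is_const_of_deriv_eq_zero
    (convex_ball s ε).isPreconnected
    (fun x hx => (hb x hx).differentiableAt.differentiableWithinAt)
    (fun x hx => (hb x hx).deriv) ht (Metric.mem_ball_self hε)

theorem Polynomial.finite_setOf_eval_eq_zero {A : ℝ[X]} (hA : A ≠ 0) :
    {t | A.eval t = 0}.Finite :=
  A.rootSet_finite ℝ |>.subset fun t ht => by
    simpa [mem_rootSet, hA] using ht

/-! ### The equation `r p = exp (L r)` -/

theorem exp_one_mul_le_exp (x : ℝ) : Real.exp 1 * x ≤ Real.exp x := by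
  have h := Real.add_one_le_exp (x - 1)
  have : Real.exp x = Real.exp 1 * Real.exp (x - 1) := by rw [← Real.exp_add]; ring_nf
  rw [this]
  exact mul_le_mul_of_nonneg_left (by linarith) (Real.exp_pos 1).le

theorem eq_one_of_exp_one_mul_eq_exp {x : ℝ} (hx : Real.exp 1 * x = Real.exp x) : x = 1 := by
  by_contra hne
  have h := Real.add_one_lt_exp (sub_ne_zero.2 hne)
  have h2 : Real.exp x = Real.exp 1 * Real.exp (x - 1) := by rw [← Real.exp_add]; ring_nf
  have := mul_lt_mul_of_pos_left h (Real.exp_pos 1)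
  rw [← h2, ← hx] at this
  linarith

theorem strictMono_mul_sub_exp {p L : ℝ} (hp : 0 < p) (hL : L ≤ 0) :
    StrictMono fun r => r * p - Real.exp (L * r) := by
  intro a b hab
  have h1 := mul_lt_mul_of_pos_right hab hp
  have h2 := Real.exp_le_exp.2 (mul_le_mul_of_nonpos_left hab.le hL)
  simp only
  linarith

theorem strictAnti_mul_sub_exp {p L : ℝ} (hp : p < 0) (hL : 0 ≤ L) :
    StrictAnti fun r => r * p - Real.exp (L * r) := by
  intro a b hab
  have h1 := mul_lt_mul_of_neg_right hab hp
  have h2 := Real.exp_le_exp.2 (mul_le_mul_of_nonneg_left hab.le hL)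
  simp only
  linarith

theorem concaveOn_mul_sub_exp (p L : ℝ) :
    ConcaveOn ℝ univ fun r => r * p - Real.exp (L * r) := by
  refine ⟨convex_univ, fun x _ y _ a b ha hb hab => ?_⟩
  have h := convexOn_exp.2 (mem_univ (L * x)) (mem_univ (L * y)) ha hb hab
  simp only [smul_eq_mul] at h ⊢
  have e : a * (L * x) + b * (L * y) = L * (a * x + b * y) := by ring
  rw [e] at h
  linarith

theorem mul_sub_exp_pos_of_between {p L a b c : ℝ} (hab : a < b) (hbc : b < c)
    (ha : 0 < a * p - Real.exp (L * a)) (hc : 0 ≤ c * p - Real.exp (L * c)) :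
    0 < b * p - Real.exp (L * b) := by
  have h1 : 0 < (c - b) / (c - a) := div_pos (by linarith) (by linarith)
  have h2 : 0 < (b - a) / (c - a) := div_pos (by linarith) (by linarith)
  have h := (concaveOn_mul_sub_exp p L).2 (mem_univ a) (mem_univ c) h1.le h2.le
    (by rw [← add_div]; exact (div_eq_one_iff_eq (by linarith)).2 (by ring))
  have hne : c - a ≠ 0 := by linarith
  have e : (c - b) / (c - a) * a + (b - a) / (c - a) * c = b := by field_simp; ring
  simp only [smul_eq_mul] at h
  rw [e] at h
  have h3 := mul_pos h1 ha
  have h4 := mul_nonneg h2.le hc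
  linarith

theorem continuous_mul_sub_exp (p L : ℝ) : Continuous fun r => r * p - Real.exp (L * r) := by
  fun_prop

theorem exists_root_of_pos_of_nonpos {p L : ℝ} (hp : 0 < p) (hL : L ≤ 0) :
    ∃ r, r * p - Real.exp (L * r) = 0 := by
  have h := intermediate_value_Icc (a := 0) (b := 1 / p) (by positivity)
    (continuous_mul_sub_exp p L).continuousOn
  obtain ⟨r, -, hr⟩ := h (show (0 : ℝ) ∈ _ by
    have : Real.exp (L * (1 / p)) ≤ 1 :=
      Real.exp_le_one_iff.2 (mul_nonpos_of_nonpos_of_nonneg hL (by positivity))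
    have h2 : 1 / p * p = 1 := by field_simp
    constructor
    · simp
    · simp only [h2]; linarith)
  exact ⟨r, hr⟩

theorem exists_root_of_neg_of_nonneg {p L : ℝ} (hp : p < 0) (hL : 0 ≤ L) :
    ∃ r, r * p - Real.exp (L * r) = 0 := by
  obtain ⟨r, hr⟩ := exists_root_of_pos_of_nonpos (p := -p) (L := -L) (by linarith) (by linarith)
  exact ⟨-r, by rw [← hr]; ring_nf⟩

/-- Apply `e x ≤ exp x` at `x = L r`, which is positive, and cancel `x`. -/
theorem exp_one_le_div_of_nonneg {p L r : ℝ} (hpL : 0 < p * L)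
    (hr : 0 ≤ r * p - Real.exp (L * r)) : Real.exp 1 ≤ p / L := by
  have hL : L ≠ 0 := right_ne_zero_of_mul hpL.ne'
  have h1 : 0 < r * p := by linarith [Real.exp_pos (L * r)]
  have h2 : 0 < L * r := by
    have : 0 < (r * p) * (p * L) := mul_pos h1 hpL
    have h3 : (r * p) * (p * L) = (L * r) * (p * p) := by ring
    rw [h3] at this
    exact pos_of_mul_pos_left this (mul_self_nonneg p)
  have h4 := exp_one_mul_le_exp (L * r)
  have h5 : r * p = p / L * (L * r) := by field_simp
  exact le_of_mul_le_mul_right (by linarith) h2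

theorem exists_lt_mul_sub_exp_neg {p L : ℝ} (hpL : 0 < p * L) :
    ∃ r, 1 / L < r ∧ r * p - Real.exp (L * r) < 0 := by
  rcases lt_trichotomy L 0 with hL | hL | hL
  · exact ⟨0, one_div_neg.2 hL, by simp⟩
  · simp [hL] at hpL
  · have hp : 0 < p := pos_of_mul_pos_left hpL hL.le
    -- With `u = p / L`, this `r` has `L r = 2u + 1` and `r p = 2u² + u`, which the quadratic lower
    -- bound for `exp` exceeds.
    refine ⟨2 * p / L ^ 2 + 1 / L, by have : 0 < 2 * p / L ^ 2 := by positivity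
                                      linarith, ?_⟩
    have h := Real.quadratic_le_exp_of_nonneg
      (show 0 ≤ L * (2 * p / L ^ 2 + 1 / L) by positivity)
    have e1 : L * (2 * p / L ^ 2 + 1 / L) = 2 * (p / L) + 1 := by field_simp
    have e2 : (2 * p / L ^ 2 + 1 / L) * p = 2 * (p / L) ^ 2 + p / L := by field_simp
    rw [e1] at h ⊢
    rw [e2]
    have : 0 < p / L := by positivity
    nlinarith

theorem mul_sub_exp_one_div_pos {p L : ℝ} (hL : L ≠ 0) (h : Real.exp 1 < p / L) :
    0 < 1 / L * p - Real.exp (L * (1 / L)) := by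
  have e : L * (1 / L) = 1 := by field_simp
  rw [e, one_div_mul_eq_div]
  linarith

theorem exists_root_gt {p L a : ℝ} (hpL : 0 < p * L) (ha : 0 < a * p - Real.exp (L * a)) :
    ∃ r, a < r ∧ r * p - Real.exp (L * r) = 0 := by
  have hb : ∃ b, a < b ∧ b * p - Real.exp (L * b) < 0 := by
    obtain ⟨b, hb, hbneg⟩ := exists_lt_mul_sub_exp_neg hpL
    rcases lt_trichotomy a b with h | h | h
    · exact ⟨b, h, hbneg⟩
    · rw [h] at ha; linarith
    -- Here `1 / L < b < a` with nonnegative values at both ends, so concavity forbids a negative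
    -- value at `b`.
    · exfalso
      have hL : L ≠ 0 := right_ne_zero_of_mul hpL.ne'
      have h1 : 0 ≤ 1 / L * p - Real.exp (L * (1 / L)) := by
        have e : L * (1 / L) = 1 := by field_simp
        rw [e, one_div_mul_eq_div]
        have := exp_one_le_div_of_nonneg hpL ha.le
        linarith
      have hc := (concaveOn_mul_sub_exp p L).min_le_of_mem_Icc (mem_univ (1 / L)) (mem_univ a)
        ⟨hb.le, h.le⟩
      have := le_min h1 ha.le
      linarith
  obtain ⟨b, hab, hb⟩ := hb
  obtain ⟨r, hr, hr0⟩ := intermediate_value_Ioo' hab.le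
    (continuous_mul_sub_exp p L).continuousOn ⟨hb, ha⟩
  exact ⟨r, hr.1, hr0⟩

theorem finite_roots_mul_sub_exp (p L : ℝ) : {r | r * p - Real.exp (L * r) = 0}.Finite := by
  have hd : ∀ r : ℝ, r ∉ (∅ : Set ℝ) →
      HasDerivAt (fun r => r * p - Real.exp (L * r)) (p - L * Real.exp (L * r)) r := by
    intro r _
    have h := ((hasDerivAt_id r).mul_const p).sub (((hasDerivAt_id r).const_mul L).exp)
    exact h.congr_deriv (by simp [mul_comm])
  by_cases h0 : p = 0 ∧ L = 0
  · have : {r : ℝ | r * p - Real.exp (L * r) = 0} = ∅ := by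
      ext r; simp [h0.1, h0.2]
    rw [this]; exact finite_empty
  have := finite_zeros_of_finite_zeros_deriv finite_empty hd (by
    apply Set.Subsingleton.finite
    rintro x ⟨-, hx⟩ y ⟨-, hy⟩
    have hL : L ≠ 0 := by
      rintro rfl
      exact h0 ⟨by simpa using hx, rfl⟩
    have : L * Real.exp (L * x) = L * Real.exp (L * y) := by linarith
    exact mul_left_cancel₀ hL (Real.exp_injective (mul_left_cancel₀ hL this)))
  simpa using this

/-! ### The largest root -/

theorem curveR_eq {P Q : ℝ[X]} {s : ℝ} (hQ : 0 < Q.eval s) (r : ℝ) :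
    curveR P Q s r = r * P.eval s - Real.exp (Real.log (Q.eval s) * r) := by
  rw [curveR, Real.rpow_def_of_pos hQ]

theorem mem_rootsAt {P Q : ℝ[X]} {s r : ℝ} : r ∈ rootsAt P Q s ↔ curveR P Q s r = 0 := by
  rw [curveR, sub_eq_zero]; rfl

theorem finite_rootsAt {P Q : ℝ[X]} {s : ℝ} (hQ : 0 < Q.eval s) : (rootsAt P Q s).Finite :=
  (finite_roots_mul_sub_exp (P.eval s) (Real.log (Q.eval s))).subset fun r hr => by
    rw [mem_rootsAt, curveR_eq hQ] at hr
    exact hr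

theorem isGreatest_implicitR {P Q : ℝ[X]} {s : ℝ} (hQ : 0 < Q.eval s)
    (h : (rootsAt P Q s).Nonempty) : IsGreatest (rootsAt P Q s) (implicitR P Q s) :=
  ⟨h.csSup_mem (finite_rootsAt hQ), fun _ hr => le_csSup (finite_rootsAt hQ).bddAbove hr⟩

theorem eval_ne_zero_of_mem_rootsAt {P Q : ℝ[X]} {s r : ℝ} (hQ : 0 < Q.eval s)
    (h : r ∈ rootsAt P Q s) : P.eval s ≠ 0 := by
  intro h0
  have := Real.rpow_pos_of_pos hQ r
  rw [← show r * P.eval s = Q.eval s ^ r from h, h0] at this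
  simp at this

/-- The threshold `m` and the sign `σ` do not depend on `t`. Either `R(t, ·)` is strictly monotone
for all `t` near `s`, or `p * L > 0` and `R(t, m) > 0`, so that concavity leaves a single sign
change beyond `m`. -/
theorem implicitR_local_sign {P Q : ℝ[X]} {s : ℝ} (hQ : 0 < Q.eval s)
    (hroot : (rootsAt P Q s).Nonempty) (h1 : Q.eval s ≠ 1 ∨ ∀ᶠ t in 𝓝 s, Q.eval t = 1)
    (h2 : P.eval s ≠ Real.exp 1 * Real.log (Q.eval s)) :
    ∃ σ m : ℝ, σ ≠ 0 ∧ m < implicitR P Q s ∧ ∀ᶠ t in 𝓝 s,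
      0 < Q.eval t ∧ (rootsAt P Q t).Nonempty ∧ ∀ r, m < r →
        (implicitR P Q t < r → 0 < σ * curveR P Q t r) ∧
        (r < implicitR P Q t → σ * curveR P Q t r < 0) := by
  have hPc : ContinuousAt (fun t => P.eval t) s := P.continuous.continuousAt
  have hQc : ContinuousAt (fun t => Q.eval t) s := Q.continuous.continuousAt
  have hLc : ContinuousAt (fun t => Real.log (Q.eval t)) s := hQc.log hQ.ne'
  have hQev : ∀ᶠ t in 𝓝 s, 0 < Q.eval t := hQc.eventually_const_lt hQ
  obtain ⟨r₀, hr₀⟩ := hroot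
  have hP : P.eval s ≠ 0 := eval_ne_zero_of_mem_rootsAt hQ hr₀
  have hgs := isGreatest_implicitR hQ ⟨r₀, hr₀⟩
  have hcases : (0 < P.eval s ∧ ∀ᶠ t in 𝓝 s, Real.log (Q.eval t) ≤ 0) ∨
      (P.eval s < 0 ∧ ∀ᶠ t in 𝓝 s, 0 ≤ Real.log (Q.eval t)) ∨
      0 < P.eval s * Real.log (Q.eval s) := by
    rcases h1 with h1 | h1
    · have hL : Real.log (Q.eval s) ≠ 0 := Real.log_ne_zero_of_pos_of_ne_one hQ h1
      rcases lt_or_gt_of_ne hP with hp | hp <;> rcases lt_or_gt_of_ne hL with hl | hl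
      · exact Or.inr (Or.inr (mul_pos_of_neg_of_neg hp hl))
      · exact Or.inr (Or.inl ⟨hp, (hLc.eventually_const_lt hl).mono fun _ h => h.le⟩)
      · exact Or.inl ⟨hp, (hLc.eventually_lt_const hl).mono fun _ h => h.le⟩
      · exact Or.inr (Or.inr (mul_pos hp hl))
    · have h0 : ∀ᶠ t in 𝓝 s, Real.log (Q.eval t) = 0 := h1.mono fun t ht => by simp [ht]
      rcases lt_or_gt_of_ne hP with hp | hp
      · exact Or.inr (Or.inl ⟨hp, h0.mono fun _ h => h.ge⟩)
      · exact Or.inl ⟨hp, h0.mono fun _ h => h.le⟩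
  rcases hcases with ⟨hp, hl⟩ | ⟨hp, hl⟩ | hpl
  · refine ⟨1, implicitR P Q s - 1, one_ne_zero, by linarith, ?_⟩
    filter_upwards [hQev, hl, hPc.eventually_const_lt hp] with t htQ htl htp
    have hne : (rootsAt P Q t).Nonempty :=
      (exists_root_of_pos_of_nonpos htp htl).imp fun r hr => by
        rw [mem_rootsAt, curveR_eq htQ, hr]
    have h0 := (isGreatest_implicitR htQ hne).1
    rw [mem_rootsAt, curveR_eq htQ] at h0
    refine ⟨htQ, hne, fun r _ => ⟨fun h => ?_, fun h => ?_⟩⟩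
    all_goals
      have := strictMono_mul_sub_exp htp htl h
      rw [curveR_eq htQ]
      simp only at this
      linarith
  · refine ⟨-1, implicitR P Q s - 1, by norm_num, by linarith, ?_⟩
    filter_upwards [hQev, hl, hPc.eventually_lt_const hp] with t htQ htl htp
    have hne : (rootsAt P Q t).Nonempty :=
      (exists_root_of_neg_of_nonneg htp htl).imp fun r hr => by
        rw [mem_rootsAt, curveR_eq htQ, hr]
    have h0 := (isGreatest_implicitR htQ hne).1
    rw [mem_rootsAt, curveR_eq htQ] at h0
    refine ⟨htQ, hne, fun r _ => ⟨fun h => ?_, fun h => ?_⟩⟩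
    all_goals
      have := strictAnti_mul_sub_exp htp htl h
      rw [curveR_eq htQ]
      simp only at this
      linarith
  · have hL : Real.log (Q.eval s) ≠ 0 := right_ne_zero_of_mul hpl.ne'
    have hle : Real.exp 1 ≤ P.eval s / Real.log (Q.eval s) :=
      exp_one_le_div_of_nonneg hpl (by rw [mem_rootsAt, curveR_eq hQ] at hr₀; exact hr₀.ge)
    have hlt : Real.exp 1 < P.eval s / Real.log (Q.eval s) :=
      lt_of_le_of_ne hle fun h => h2 (by rw [h]; field_simp)
    have hm := mul_sub_exp_one_div_pos hL hlt
    -- At `r = 1 / L` the value is `p / L - e`, positive off the tangency, and it stays positive at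
    -- this fixed `r` for nearby `t`.
    set m := 1 / Real.log (Q.eval s) with hmdef
    obtain ⟨r₁, hr₁, hr₁0⟩ := exists_root_gt hpl hm
    refine ⟨-1, m, by norm_num, lt_of_lt_of_le hr₁ (hgs.2 ?_), ?_⟩
    · rw [mem_rootsAt, curveR_eq hQ, hr₁0]
    have hc : ContinuousAt (fun t => m * P.eval t - Real.exp (Real.log (Q.eval t) * m)) s :=
      (hPc.const_mul m).sub (hLc.mul_const m).rexp
    filter_upwards [hQev, (hPc.mul hLc).eventually_const_lt hpl, hc.eventually_const_lt hm]
      with t htQ htpl htm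
    obtain ⟨r₂, hr₂, hr₂0⟩ := exists_root_gt htpl htm
    have hmem : r₂ ∈ rootsAt P Q t := by rw [mem_rootsAt, curveR_eq htQ, hr₂0]
    have hg := isGreatest_implicitR htQ ⟨r₂, hmem⟩
    have hmt : m < implicitR P Q t := hr₂.trans_le (hg.2 hmem)
    have h0 := hg.1
    rw [mem_rootsAt, curveR_eq htQ] at h0
    refine ⟨htQ, ⟨r₂, hmem⟩, fun r hmr => ⟨fun h => ?_, fun h => ?_⟩⟩
    · rw [curveR_eq htQ]
      by_contra hcon
      have := mul_sub_exp_pos_of_between hmt h htm (by linarith)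
      linarith
    · rw [curveR_eq htQ]
      have := mul_sub_exp_pos_of_between hmr h htm h0.ge
      linarith

/-! ### Extrema of the largest root solve the Pfaffian system -/

theorem hasDerivAt_curveR {P Q : ℝ[X]} {s : ℝ} (hQ : 0 < Q.eval s) (r : ℝ) :
    HasDerivAt (fun t => curveR P Q t r)
      (r * (derivative P).eval s - (derivative Q).eval s * r * Q.eval s ^ (r - 1)) s :=
  ((P.hasDerivAt s).const_mul r).sub ((Q.hasDerivAt s).rpow_const (Or.inl hQ.ne'))

theorem deriv_curveR_eq_zero_of_isLocalExtrOn {P Q : ℝ[X]} {I : Set ℝ} {s σ m : ℝ}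
    (hD : implicitDomain P Q I ∈ 𝓝 s) (hσ : σ ≠ 0) (hm : m < implicitR P Q s)
    (h : ∀ᶠ t in 𝓝 s, ∀ r, m < r →
        (implicitR P Q t < r → 0 < σ * curveR P Q t r) ∧
        (r < implicitR P Q t → σ * curveR P Q t r < 0))
    (hext : IsLocalExtrOn (implicitR P Q) (implicitDomain P Q I) s) :
    deriv (fun t => curveR P Q t (implicitR P Q s)) s = 0 := by
  have hroot : ∀ t ∈ implicitDomain P Q I, curveR P Q t (implicitR P Q t) = 0 :=
    fun t ht => mem_rootsAt.1 (isGreatest_implicitR ht.2.1 ht.2.2).1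
  have h0 := hroot s (mem_of_mem_nhds hD)
  have hext' : IsLocalExtr (implicitR P Q) s := hext.isLocalExtr hD
  have key : IsLocalExtr (fun t => σ * curveR P Q t (implicitR P Q s)) s := by
    rcases hext' with he | he
    · right
      filter_upwards [he, h, hD] with t ht hs htD
      simp only [h0, mul_zero]
      rcases eq_or_lt_of_le ht with e | hlt
      · rw [e, hroot t htD, mul_zero]
      · exact ((hs _ hm).2 hlt).le
    · left
      filter_upwards [he, h, hD] with t ht hs htD
      simp only [h0, mul_zero]
      rcases eq_or_lt_of_le ht with e | hlt
      · rw [← e, hroot t htD, mul_zero]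
      · exact ((hs _ hm).1 hlt).le
  have := key.deriv_eq_zero
  rw [deriv_const_mul_field] at this
  exact (mul_eq_zero.1 this).resolve_left hσ

/-- Roots exist for all nearby `t`, so `P / log Q ≥ e` there, with equality at `s`. Hence `P' = e Q'
/ Q` at `s`, and with `L r = 1` this is `∂R/∂s = 0`. -/
theorem deriv_curveR_eq_zero_of_tangent {P Q : ℝ[X]} {I : Set ℝ} {s : ℝ}
    (hD : implicitDomain P Q I ∈ 𝓝 s) (hQ1 : Q.eval s ≠ 1)
    (h : P.eval s = Real.exp 1 * Real.log (Q.eval s)) :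
    deriv (fun t => curveR P Q t (implicitR P Q s)) s = 0 := by
  obtain ⟨-, hQ, hne⟩ := mem_of_mem_nhds hD
  have hL : Real.log (Q.eval s) ≠ 0 := Real.log_ne_zero_of_pos_of_ne_one hQ hQ1
  have hPc : ContinuousAt (fun t => P.eval t) s := P.continuous.continuousAt
  have hLc : ContinuousAt (fun t => Real.log (Q.eval t)) s :=
    Q.continuous.continuousAt.log hQ.ne'
  have hpl : 0 < P.eval s * Real.log (Q.eval s) := by
    rw [h, mul_assoc]
    exact mul_pos (Real.exp_pos 1) (mul_self_pos.2 hL)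
  set r := implicitR P Q s with hr
  have h0 := (isGreatest_implicitR hQ hne).1
  rw [← hr] at h0
  have hrp : r * P.eval s = Q.eval s ^ r := h0
  have hLr : Real.log (Q.eval s) * r = 1 := by
    apply eq_one_of_exp_one_mul_eq_exp
    rw [mem_rootsAt, curveR_eq hQ, h] at h0
    linarith
  have hd : HasDerivAt (fun t => Real.log (Q.eval s) *
      (P.eval t - Real.exp 1 * Real.log (Q.eval t)))
      (Real.log (Q.eval s) * ((derivative P).eval s -
        Real.exp 1 * ((derivative Q).eval s / Q.eval s))) s :=
    ((P.hasDerivAt s).sub (((Q.hasDerivAt s).log hQ.ne').const_mul _)).const_mul _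
  -- The factor `log Q(s)` makes the extremum a minimum for either sign of the logarithm.
  have hmin : IsLocalMin (fun t => Real.log (Q.eval s) *
      (P.eval t - Real.exp 1 * Real.log (Q.eval t))) s := by
    filter_upwards [hD, (hPc.mul hLc).eventually_const_lt hpl,
      (hLc.const_mul (Real.log (Q.eval s))).eventually_const_lt (mul_self_pos.2 hL)]
      with t ⟨_, htQ, r', hr'⟩ htpl htl
    rw [mem_rootsAt, curveR_eq htQ] at hr'
    have hle := exp_one_le_div_of_nonneg htpl hr'.ge
    have htL : Real.log (Q.eval t) ≠ 0 := right_ne_zero_of_mul htpl.ne'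
    have e : Real.log (Q.eval s) * (P.eval t - Real.exp 1 * Real.log (Q.eval t)) =
        (Real.log (Q.eval s) * Real.log (Q.eval t)) *
          (P.eval t / Real.log (Q.eval t) - Real.exp 1) := by field_simp
    rw [e, h, sub_self, mul_zero]
    exact mul_nonneg htl.le (by linarith)
  have hz := (mul_eq_zero.1 (hmin.hasDerivAt_eq_zero hd)).resolve_left hL
  rw [(hasDerivAt_curveR hQ r).deriv, Real.rpow_sub_one hQ.ne', ← hrp, h]
  have hP' : (derivative P).eval s = Real.exp 1 * ((derivative Q).eval s / Q.eval s) := by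
    linarith
  rw [hP']
  linear_combination (-r * Real.exp 1 * (derivative Q).eval s / Q.eval s) * hLr

/-! ### Finiteness of the solutions of the Pfaffian system -/

theorem eval_derivative_mul_of_pfaffian {P Q : ℝ[X]} {s r : ℝ} (hQ : 0 < Q.eval s)
    (h0 : curveR P Q s r = 0) (h1 : deriv (fun t => curveR P Q t r) s = 0) :
    (derivative P).eval s * Q.eval s = r * (P.eval s * (derivative Q).eval s) := by
  rw [(hasDerivAt_curveR hQ r).deriv, Real.rpow_sub_one hQ.ne'] at h1
  have hrp : r * P.eval s = Q.eval s ^ r := sub_eq_zero.1 h0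
  have hr : r ≠ 0 := by
    rintro rfl
    simp at hrp
  rw [← hrp] at h1
  have hne := hQ.ne'
  apply mul_left_cancel₀ hr
  field_simp at h1
  linear_combination h1

/-- In degree `2p + 2q + 1`, where `deg P = p + 1` and `deg Q = q + 1`, the two Wronskian terms
cancel and only the nonzero leading coefficient of `Q' P'² Q` remains. -/
theorem wronskian_add_ne_zero {P Q : ℝ[X]} (hP : derivative P ≠ 0) (hQ : derivative Q ≠ 0) :
    derivative Q * derivative P ^ 2 * Q +
      (derivative (derivative P * Q) * (P * derivative Q) -
        derivative P * Q * derivative (P * derivative Q)) ≠ 0 := by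
  have hp : P.natDegree ≠ 0 := fun h => hP (derivative_of_natDegree_zero h)
  have hq : Q.natDegree ≠ 0 := fun h => hQ (derivative_of_natDegree_zero h)
  obtain ⟨p, hp⟩ := Nat.exists_eq_succ_of_ne_zero hp
  obtain ⟨q, hq⟩ := Nat.exists_eq_succ_of_ne_zero hq
  have hP0 : P ≠ 0 := by rintro rfl; simp at hP
  have hQ0 : Q ≠ 0 := by rintro rfl; simp at hQ
  have hP1 : P.natDegree ≤ p + 1 := hp.le
  have hQ1 : Q.natDegree ≤ q + 1 := hq.le
  have hP' : (derivative P).natDegree ≤ p := by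
    have := natDegree_derivative_le P; omega
  have hQ' : (derivative Q).natDegree ≤ q := by
    have := natDegree_derivative_le Q; omega
  have hA : (derivative P * Q).natDegree ≤ p + q + 1 := natDegree_mul_le.trans (by omega)
  have hB : (P * derivative Q).natDegree ≤ p + q + 1 := natDegree_mul_le.trans (by omega)
  have hA' : (derivative (derivative P * Q)).natDegree ≤ p + q :=
    (natDegree_derivative_le _).trans (by omega)
  have hB' : (derivative (P * derivative Q)).natDegree ≤ p + q :=
    (natDegree_derivative_le _).trans (by omega)
  have hP2 : (derivative P ^ 2).natDegree ≤ 2 * p := natDegree_pow_le.trans (by omega)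
  have cA : (derivative P * Q).coeff (p + q + 1) =
      P.leadingCoeff * (p + 1) * Q.leadingCoeff := by
    rw [add_assoc, coeff_mul_add_eq_of_natDegree_le hP' hQ1, coeff_derivative, leadingCoeff,
      leadingCoeff, hp, hq]
  have cB : (P * derivative Q).coeff (p + q + 1) =
      P.leadingCoeff * (Q.leadingCoeff * (q + 1)) := by
    rw [show p + q + 1 = (p + 1) + q by ring, coeff_mul_add_eq_of_natDegree_le hP1 hQ',
      coeff_derivative, leadingCoeff, leadingCoeff, hp, hq]
  have c1 : (derivative (derivative P * Q) * (P * derivative Q)).coeff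
      ((p + q) + (p + q + 1)) =
      (derivative P * Q).coeff (p + q + 1) * (p + q + 1) *
        (P * derivative Q).coeff (p + q + 1) := by
    rw [coeff_mul_add_eq_of_natDegree_le hA' hB, coeff_derivative]
    push_cast
    ring
  have c2 : (derivative P * Q * derivative (P * derivative Q)).coeff
      ((p + q + 1) + (p + q)) =
      (derivative P * Q).coeff (p + q + 1) * ((P * derivative Q).coeff (p + q + 1) *
        (p + q + 1)) := by
    rw [coeff_mul_add_eq_of_natDegree_le hA hB', coeff_derivative]
    push_cast
    ring
  have c3 : (derivative Q * derivative P ^ 2 * Q).coeff ((q + 2 * p) + (q + 1)) =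
      Q.leadingCoeff * (q + 1) * (P.leadingCoeff * (p + 1)) ^ 2 * Q.leadingCoeff := by
    rw [coeff_mul_add_eq_of_natDegree_le (natDegree_mul_le.trans (add_le_add hQ' hP2)) hQ1,
      coeff_mul_add_eq_of_natDegree_le hQ' hP2, coeff_derivative,
      coeff_pow_of_natDegree_le hP', coeff_derivative, leadingCoeff, leadingCoeff, hp, hq]
  intro h
  have h' := congrArg (fun A => A.coeff (2 * p + 2 * q + 1)) h
  simp only [coeff_add, coeff_sub, coeff_zero] at h'
  rw [show 2 * p + 2 * q + 1 = (p + q) + (p + q + 1) by ring, c1,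
    show (p + q) + (p + q + 1) = (p + q + 1) + (p + q) by ring, c2,
    show (p + q + 1) + (p + q) = (q + 2 * p) + (q + 1) by ring, c3] at h'
  have hne : Q.leadingCoeff * (q + 1) * (P.leadingCoeff * (p + 1)) ^ 2 * Q.leadingCoeff ≠ 0 := by
    have := leadingCoeff_ne_zero.2 hP0
    have := leadingCoeff_ne_zero.2 hQ0
    have : (q : ℝ) + 1 ≠ 0 := by positivity
    have : (p : ℝ) + 1 ≠ 0 := by positivity
    positivity
  apply hne
  linear_combination h'

/-- Compare degrees: if `P' ≠ 0`, the left side has degree at least `deg Q > deg Q'`. -/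
theorem Polynomial.derivative_eq_zero_of_mul_eq {P Q : ℝ[X]} {c : ℝ} (hc : c ≠ 0)
    (hQ : Q ≠ 0) (h : derivative P * Q = C c * derivative Q) :
    derivative P = 0 ∧ derivative Q = 0 := by
  by_cases hP' : derivative P = 0
  · rw [hP', zero_mul] at h
    exact ⟨hP', (mul_eq_zero.1 h.symm).resolve_left (C_ne_zero.2 hc)⟩
  · exfalso
    have hQ' : derivative Q ≠ 0 := by
      intro h0
      rw [h0, mul_zero] at h
      exact (mul_ne_zero hP' hQ) h
    have h1 := congrArg natDegree h
    rw [natDegree_mul hP' hQ, natDegree_C_mul hc] at h1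
    have h2 : (derivative Q).natDegree < Q.natDegree :=
      natDegree_derivative_lt fun h => hQ' (derivative_of_natDegree_zero h)
    omega

theorem finite_setOf_eval_eq_mul_log {P Q : ℝ[X]}
    (h : ¬ (derivative P = 0 ∧ derivative Q = 0)) :
    {t | 0 < Q.eval t ∧ P.eval t = Real.exp 1 * Real.log (Q.eval t)}.Finite := by
  by_cases hQ : Q = 0
  · simp [hQ]
  have hne : derivative P * Q - C (Real.exp 1) * derivative Q ≠ 0 := fun h0 =>
    h (derivative_eq_zero_of_mul_eq (Real.exp_ne_zero 1) hQ (sub_eq_zero.1 h0))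
  refine (finite_zeros_of_finite_zeros_deriv (finite_setOf_eval_eq_zero hQ)
    (f := fun t => P.eval t - Real.exp 1 * Real.log (Q.eval t))
    (f' := fun t => (derivative P).eval t -
      Real.exp 1 * ((derivative Q).eval t / Q.eval t))
    (fun t ht => (P.hasDerivAt t).sub (((Q.hasDerivAt t).log ht).const_mul _)) ?_).subset ?_
  · refine (finite_setOf_eval_eq_zero hne).subset fun t ⟨ht, ht0⟩ => ?_
    have ht' : Q.eval t ≠ 0 := ht
    simp only [mem_ofPred_eq, eval_sub, eval_mul, eval_C] at ht0 ⊢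
    field_simp at ht0
    linarith
  · exact fun t ht => ⟨ht.1.ne', sub_eq_zero.2 ht.2⟩

/-- Away from finitely many points, a solution `(s, r)` of the Pfaffian system lies on a horizontal
segment of solutions of `R = 0`. -/
theorem finite_pfaffian_not_eventually (P Q : ℝ[X]) :
    {s | ∃ r, 0 < Q.eval s ∧ curveR P Q s r = 0 ∧ deriv (fun t => curveR P Q t r) s = 0 ∧
      ¬ ∀ᶠ t in 𝓝 s, curveR P Q t r = 0}.Finite := by
  by_cases hP' : derivative P = 0
  · by_cases hQ' : derivative Q = 0
    · convert finite_empty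
      rw [Set.eq_empty_iff_forall_notMem]
      rintro s ⟨r, -, h0, -, hn⟩
      refine hn (Eventually.of_forall fun t => ?_)
      rw [← h0, eq_C_of_derivative_eq_zero hP', eq_C_of_derivative_eq_zero hQ']
      simp [curveR]
    · refine (finite_setOf_eval_eq_zero hQ').subset ?_
      rintro s ⟨r, hQ, h0, h1, -⟩
      have := eval_derivative_mul_of_pfaffian hQ h0 h1
      rw [hP', eval_zero, zero_mul, ← mul_assoc,
        show r * P.eval s = Q.eval s ^ r from sub_eq_zero.1 h0] at this
      exact (mul_eq_zero.1 this.symm).resolve_left (Real.rpow_pos_of_pos hQ r).ne'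
  by_cases hQ' : derivative Q = 0
  · refine (finite_setOf_eval_eq_zero hP').subset ?_
    rintro s ⟨r, hQ, h0, h1, -⟩
    have := eval_derivative_mul_of_pfaffian hQ h0 h1
    rw [hQ', eval_zero, mul_zero, mul_zero] at this
    exact (mul_eq_zero.1 this).resolve_right hQ.ne'
  have hP0 : P ≠ 0 := by rintro rfl; simp at hP'
  have hQ0 : Q ≠ 0 := by rintro rfl; simp at hQ'
  set F : Set ℝ := {t | (P * derivative P * (Q * derivative Q)).eval t = 0} with hFdef
  have hF : F.Finite := finite_setOf_eval_eq_zero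
    (mul_ne_zero (mul_ne_zero hP0 hP') (mul_ne_zero hQ0 hQ'))
  have hmemF : ∀ t, t ∉ F → P.eval t ≠ 0 ∧ (derivative P).eval t ≠ 0 ∧ Q.eval t ≠ 0 ∧
      (derivative Q).eval t ≠ 0 := by
    intro t ht
    simpa [hFdef, not_or, and_assoc] using ht
  set A := derivative P * Q with hA
  set B := P * derivative Q with hB
  set W := derivative A * B - A * derivative B with hW
  set ρ : ℝ → ℝ := fun t => A.eval t / B.eval t with hρ
  have hAB : ∀ t, t ∉ F → A.eval t ≠ 0 ∧ B.eval t ≠ 0 := by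
    intro t ht
    obtain ⟨h1, h2, h3, h4⟩ := hmemF t ht
    rw [hA, hB, eval_mul, eval_mul]
    exact ⟨mul_ne_zero h2 h3, mul_ne_zero h1 h4⟩
  have hρd : ∀ t, t ∉ F → HasDerivAt ρ (W.eval t / B.eval t ^ 2) t := by
    intro t ht
    have h := (A.hasDerivAt t).div (B.hasDerivAt t) (hAB t ht).2
    exact h.congr_deriv (by simp [hW])
  have hhd : ∀ t, t ∉ F → HasDerivAt
      (fun t => ρ t * Real.log (Q.eval t) - Real.log (ρ t * P.eval t))
      (W.eval t / B.eval t ^ 2 * (Real.log (Q.eval t) - B.eval t / A.eval t)) t := by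
    intro t ht
    obtain ⟨h1, h2, h3, h4⟩ := hmemF t ht
    obtain ⟨h5, h6⟩ := hAB t ht
    have h7 : ρ t ≠ 0 := div_ne_zero h5 h6
    have h := ((hρd t ht).mul ((Q.hasDerivAt t).log h3)).sub
      (((hρd t ht).mul (P.hasDerivAt t)).log (mul_ne_zero h7 h1))
    refine h.congr_deriv ?_
    have e : ρ t * ((derivative Q).eval t / Q.eval t) = (derivative P).eval t / P.eval t := by
      simp only [hρ, hA, hB, eval_mul]
      field_simp
    rw [e, Pi.mul_apply, add_div, mul_div_mul_right _ _ h1, mul_div_mul_left _ _ h7]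
    simp only [hρ]
    field_simp
    ring
  have hkd : ∀ t, t ∉ F → HasDerivAt (fun t => Real.log (Q.eval t) - B.eval t / A.eval t)
      ((derivative Q * derivative P ^ 2 * Q + W).eval t / A.eval t ^ 2) t := by
    intro t ht
    obtain ⟨h1, h2, h3, h4⟩ := hmemF t ht
    obtain ⟨h5, h6⟩ := hAB t ht
    have h := ((Q.hasDerivAt t).log h3).sub ((B.hasDerivAt t).div (A.hasDerivAt t) h5)
    refine h.congr_deriv ?_
    have e : A.eval t = (derivative P).eval t * Q.eval t := by simp [hA]
    simp only [hW, eval_add, eval_sub, eval_mul, eval_pow]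
    rw [e] at h5 ⊢
    field_simp
    ring
  -- First use of Rolle, for the factor `log Q - 1/ρ` of `h'`; the second, for `h` itself, is `hz`.
  have hk : {t | t ∉ F ∧ Real.log (Q.eval t) - B.eval t / A.eval t = 0}.Finite := by
    refine finite_zeros_of_finite_zeros_deriv hF hkd
      ((finite_setOf_eval_eq_zero (wronskian_add_ne_zero hP' hQ')).subset ?_)
    rintro t ⟨ht, ht0⟩
    exact (div_eq_zero_iff.1 ht0).resolve_right (pow_ne_zero 2 (hAB t ht).1)
  have hsol : ∀ s r, s ∉ F → 0 < Q.eval s → curveR P Q s r = 0 →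
      deriv (fun t => curveR P Q t r) s = 0 → r = ρ s ∧ 0 < ρ s * P.eval s ∧
        ρ s * Real.log (Q.eval s) - Real.log (ρ s * P.eval s) = 0 := by
    intro s r hs hQ h0 h1
    have hr : r = ρ s := by
      rw [hρ, eq_div_iff (hAB s hs).2, hA, hB, eval_mul, eval_mul]
      exact (eval_derivative_mul_of_pfaffian hQ h0 h1).symm
    have hrp : r * P.eval s = Q.eval s ^ r := sub_eq_zero.1 h0
    rw [← hr, hrp, Real.log_rpow hQ, sub_self]
    exact ⟨rfl, Real.rpow_pos_of_pos hQ r, rfl⟩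
  -- `W` is the numerator of `ρ'`. If it vanishes, `ρ` and `h` are locally constant off `F`, so a
  -- solution extends to a horizontal segment.
  by_cases hW0 : W = 0
  · refine hF.subset ?_
    rintro s ⟨r, hQ, h0, h1, hn⟩
    by_contra hs
    obtain ⟨hr, hpos, hh⟩ := hsol s r hs hQ h0 h1
    have hFn : ∀ᶠ t in 𝓝 s, t ∉ F := hF.isClosed.isOpen_compl.mem_nhds hs
    have hρc := eventually_eq_of_eventually_hasDerivAt_zero
      (hFn.mono fun t ht => by simpa [hW0] using hρd t ht)
    have hhc := eventually_eq_of_eventually_hasDerivAt_zero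
      (hFn.mono fun t ht => by simpa [hW0] using hhd t ht)
    have hQc : ContinuousAt (fun t => Q.eval t) s := Q.continuous.continuousAt
    have hPc : ContinuousAt (fun t => r * P.eval t) s :=
      P.continuous.continuousAt.const_mul r
    rw [← hr] at hpos
    apply hn
    filter_upwards [hρc, hhc, hQc.eventually_const_lt hQ, hPc.eventually_const_lt hpos]
      with t h2 h3 h4 h5
    rw [hh, h2, ← hr] at h3
    rw [curveR, Real.rpow_def_of_pos h4, mul_comm (Real.log _), sub_eq_zero.1 h3,
      Real.exp_log h5, sub_self]
  · have hz := finite_zeros_of_finite_zeros_deriv hF hhd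
      (((finite_setOf_eval_eq_zero hW0).union hk).subset ?_)
    · refine (hF.union hz).subset ?_
      rintro s ⟨r, hQ, h0, h1, -⟩
      by_cases hs : s ∈ F
      · exact Or.inl hs
      · exact Or.inr ⟨hs, (hsol s r hs hQ h0 h1).2.2⟩
    · rintro t ⟨ht, ht0⟩
      rcases mul_eq_zero.1 ht0 with h | h
      · exact Or.inl ((div_eq_zero_iff.1 h).resolve_right (pow_ne_zero 2 (hAB t ht).2))
      · exact Or.inr ⟨ht, h⟩

/-! ### Exceptional points -/

theorem Set.OrdConnected.finite_setOf_notMem_nhds {I : Set ℝ} (hI : I.OrdConnected) :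
    {s | s ∈ I ∧ I ∉ 𝓝 s}.Finite := by
  have h1 : {s | IsLeast I s}.Subsingleton := fun a ha b hb => ha.unique hb
  have h2 : {s | IsGreatest I s}.Subsingleton := fun a ha b hb => ha.unique hb
  refine (h1.finite.union h2.finite).subset fun s ⟨hs, hn⟩ => ?_
  by_contra hcon
  simp only [mem_union, mem_ofPred_eq, IsLeast, IsGreatest, hs, true_and, lowerBounds, upperBounds,
    not_or, not_forall, not_le] at hcon
  obtain ⟨⟨a, ha, has⟩, b, hb, hsb⟩ := hcon
  exact hn (mem_of_superset (Icc_mem_nhds has hsb) (hI.out ha hb))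

theorem finite_setOf_eval_eq_one_not_eventually (Q : ℝ[X]) :
    {s | Q.eval s = 1 ∧ ¬ ∀ᶠ t in 𝓝 s, Q.eval t = 1}.Finite := by
  by_cases h : Q - 1 = 0
  · simp [sub_eq_zero.1 h]
  · exact (finite_setOf_eval_eq_zero h).subset fun s hs => by simp [hs.1]

/-- Since `s` may be an endpoint of `I`, the interval is taken on one side of `s`, towards another
point of `I`. -/
theorem Set.OrdConnected.exists_Ioo_subset_of_eventually {I : Set ℝ} (hI : I.OrdConnected)
    (hI2 : I.Nontrivial) {s : ℝ} (hs : s ∈ I) {p : ℝ → Prop} (hp : ∀ᶠ t in 𝓝 s, p t) :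
    ∃ a b, a < b ∧ Ioo a b ⊆ I ∧ ∀ t ∈ Ioo a b, p t := by
  obtain ⟨u, hu, hus⟩ := hI2.exists_ne s
  obtain ⟨ε, hε, hb⟩ := Metric.eventually_nhds_iff_ball.1 hp
  rcases lt_or_gt_of_ne hus with h | h
  · refine ⟨max u (s - ε), s, max_lt h (by linarith), fun t ht => hI.out hu hs
      ⟨(le_max_left _ _).trans ht.1.le, ht.2.le⟩, fun t ht => hb t ?_⟩
    have := (le_max_right u (s - ε)).trans_lt ht.1
    rw [Metric.mem_ball, Real.dist_eq, abs_lt]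
    constructor <;> linarith [ht.2]
  · refine ⟨s, min u (s + ε), lt_min h (by linarith), fun t ht => hI.out hs hu
      ⟨ht.1.le, ht.2.le.trans (min_le_left _ _)⟩, fun t ht => hb t ?_⟩
    have := ht.2.trans_le (min_le_right u (s + ε))
    rw [Metric.mem_ball, Real.dist_eq, abs_lt]
    constructor <;> linarith [ht.1]

theorem finite_pfaffianSolutions {P Q : ℝ[X]} {I : Set ℝ} (hI : I.OrdConnected)
    (h : NoConstantRoot P Q I) : (pfaffianSolutions P Q I).Finite := by
  have hfst : (Prod.fst '' pfaffianSolutions P Q I).Finite := by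
    rcases I.subsingleton_or_nontrivial with hI1 | hI2
    · refine hI1.finite.subset ?_
      rintro _ ⟨p, hp, rfl⟩
      exact hp.1
    · refine (finite_pfaffian_not_eventually P Q).subset ?_
      rintro _ ⟨⟨s, r⟩, ⟨hs, hQ, h0, h1⟩, rfl⟩
      refine ⟨r, hQ, h0, h1, fun hev => ?_⟩
      have hQc : ContinuousAt (fun t => Q.eval t) s := Q.continuous.continuousAt
      obtain ⟨a, b, hab, hsub, hall⟩ := hI.exists_Ioo_subset_of_eventually hI2 hs
        ((hQc.eventually_const_lt hQ).and hev)
      exact h r a b hab hsub fun t ht => ⟨(hall t ht).1, sub_eq_zero.1 (hall t ht).2⟩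
  have hfin : (⋃ s ∈ Prod.fst '' pfaffianSolutions P Q I,
      {p : ℝ × ℝ | p ∈ pfaffianSolutions P Q I ∧ p.1 = s}).Finite := by
    refine hfst.biUnion fun s hs => ?_
    obtain ⟨q, hq, rfl⟩ := hs
    refine ((finite_rootsAt (P := P) hq.2.1).image fun r => (q.1, r)).subset ?_
    rintro ⟨s, r⟩ ⟨hp, rfl⟩
    exact ⟨r, mem_rootsAt.2 hp.2.2.1, rfl⟩
  refine hfin.subset fun p hp => ?_
  simp only [mem_iUnion]
  exact ⟨p.1, mem_image_of_mem _ hp, hp, rfl⟩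

theorem finite_localExtr_not_eventually_const (P Q : ℝ[X]) {I : Set ℝ} (hI : I.OrdConnected) :
    {s | s ∈ implicitDomain P Q I ∧
      IsLocalExtrOn (implicitR P Q) (implicitDomain P Q I) s ∧
      ¬ ∀ᶠ t in 𝓝 s, t ∈ implicitDomain P Q I ∧ implicitR P Q t = implicitR P Q s}.Finite := by
  -- For constant `P` and `Q` every point may be a tangency, but then `r` is constant and only
  -- endpoints of `I` remain.
  by_cases hconst : derivative P = 0 ∧ derivative Q = 0
  · refine hI.finite_setOf_notMem_nhds.subset fun s ⟨hs, _, hn⟩ => ⟨hs.1, fun hmem => hn ?_⟩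
    filter_upwards [hmem] with t ht
    have hroots : rootsAt P Q t = rootsAt P Q s := by
      rw [eq_C_of_derivative_eq_zero hconst.1, eq_C_of_derivative_eq_zero hconst.2]
      simp [rootsAt]
    have hQt : Q.eval t = Q.eval s := by
      rw [eq_C_of_derivative_eq_zero hconst.2]
      simp
    exact ⟨⟨ht, hQt ▸ hs.2.1, hroots ▸ hs.2.2⟩, by rw [implicitR, implicitR, hroots]⟩
  · refine (((hI.finite_setOf_notMem_nhds.union
      (finite_setOf_eval_eq_one_not_eventually Q)).union
      (finite_setOf_eval_eq_mul_log hconst)).union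
      (finite_pfaffian_not_eventually P Q)).subset ?_
    rintro s ⟨hs, hext, hn⟩
    by_contra hcon
    simp only [mem_union, not_or] at hcon
    obtain ⟨⟨⟨hn1, hn2⟩, hn3⟩, hn4⟩ := hcon
    have hImem : I ∈ 𝓝 s := by
      by_contra hh
      exact hn1 ⟨hs.1, hh⟩
    have h1 : Q.eval s ≠ 1 ∨ ∀ᶠ t in 𝓝 s, Q.eval t = 1 := by
      by_contra hh
      rw [not_or, not_not] at hh
      exact hn2 hh
    obtain ⟨σ, m, hσ, hm, hev⟩ := implicitR_local_sign hs.2.1 hs.2.2 h1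
      fun hh => hn3 ⟨hs.2.1, hh⟩
    have hD : implicitDomain P Q I ∈ 𝓝 s := by
      filter_upwards [hImem, hev] with t ht htv
      exact ⟨ht, htv.1, htv.2.1⟩
    have hd := deriv_curveR_eq_zero_of_isLocalExtrOn hD hσ hm (hev.mono fun t ht => ht.2.2) hext
    have hconst' : ∀ᶠ t in 𝓝 s, curveR P Q t (implicitR P Q s) = 0 := by
      by_contra hh
      exact hn4 ⟨_, hs.2.1, mem_rootsAt.1 (isGreatest_implicitR hs.2.1 hs.2.2).1, hd, hh⟩
    refine hn ?_
    filter_upwards [hD, hev, hconst'] with t htD htv ht0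
    refine ⟨htD, ?_⟩
    -- As `R(t, r(s)) = 0`, neither strict sign is possible, so `r(t) = r(s)`.
    have h2 := htv.2.2 _ hm
    rw [ht0, mul_zero] at h2
    exact le_antisymm (not_lt.1 fun hh => lt_irrefl _ (h2.2 hh))
      (not_lt.1 fun hh => lt_irrefl _ (h2.1 hh))

theorem mainTheorem5 (P Q : ℝ[X]) (I : Set ℝ) (hI : I.OrdConnected) :
    (∀ s ∈ implicitDomain P Q I, IsGreatest (rootsAt P Q s) (implicitR P Q s)) ∧
    {s | s ∈ implicitDomain P Q I ∧
      IsLocalExtrOn (implicitR P Q) (implicitDomain P Q I) s ∧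
      ¬ ∀ᶠ t in 𝓝 s, t ∈ implicitDomain P Q I ∧ implicitR P Q t = implicitR P Q s}.Finite ∧
    (∀ s, implicitDomain P Q I ∈ 𝓝 s → Q.eval s ≠ 1 →
      IsLocalExtrOn (implicitR P Q) (implicitDomain P Q I) s →
      (s, implicitR P Q s) ∈ pfaffianSolutions P Q I) ∧
    (NoConstantRoot P Q I →
      {s | s ∈ implicitDomain P Q I ∧
        IsLocalExtrOn (implicitR P Q) (implicitDomain P Q I) s}.Finite ∧
      (pfaffianSolutions P Q I).Finite) := by
  refine ⟨fun s hs => isGreatest_implicitR hs.2.1 hs.2.2,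
    finite_localExtr_not_eventually_const P Q hI, fun s hD hQ1 hext => ?_,
    fun h => ⟨?_, finite_pfaffianSolutions hI h⟩⟩
  · have hs := mem_of_mem_nhds hD
    refine ⟨hs.1, hs.2.1, mem_rootsAt.1 (isGreatest_implicitR hs.2.1 hs.2.2).1, ?_⟩
    by_cases ht : P.eval s = Real.exp 1 * Real.log (Q.eval s)
    · exact deriv_curveR_eq_zero_of_tangent hD hQ1 ht
    · obtain ⟨σ, m, hσ, hm, hev⟩ := implicitR_local_sign hs.2.1 hs.2.2 (Or.inl hQ1) ht
      exact deriv_curveR_eq_zero_of_isLocalExtrOn hD hσ hm (hev.mono fun t ht => ht.2.2) hext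
  · refine (finite_localExtr_not_eventually_const P Q hI).subset fun s ⟨hs, hext⟩ =>
      ⟨hs, hext, fun hev => ?_⟩
    -- A locally constant `r = c` would give the excluded identity `c P = Q^c` on an interval.
    obtain ⟨ε, hε, hb⟩ := Metric.eventually_nhds_iff_ball.1 hev
    rw [Real.ball_eq_Ioo] at hb
    refine h (implicitR P Q s) (s - ε) (s + ε) (by linarith) (fun t ht => (hb t ht).1.1)
      fun t ht => ?_
    obtain ⟨htD, hteq⟩ := hb t ht
    refine ⟨htD.2.1, ?_⟩
    rw [← hteq]
    exact (isGreatest_implicitR htD.2.1 htD.2.2).1
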